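/- Let $T$ be a finite rooted tree. Order its vertices by $v \preceq w$ if and only if $v$ lies on the path from the root to $w$; any two vertices $u,v$ then have an infimum $u\wedge v$, their last common vertex on the paths from the root. A set $X$ of vertices is called infima closed if $u \wedge v\in X$ for all $u,v\in X$. Let $I(T)$ be the number of nonempty infima closed sets of $T$, and for $n\ge 1$ let $m_n=\min_{|T|=n} I(T)$, where the minimum is over all rooted trees with $n$ vertices. Define $x_1=13$ and $x_{k+1}=x_k^2-1$ for $k\ge 1$. The series $$\beta=\frac12\log x_1+\sum_{j=1}^{\infty}2^{-j-1}\log\bigl(1-x_j^{-2}\bigr)$$ converges. Put $\alpha=e^{2\beta/5}$; to 25 decimal places, $\alpha\approx 1.6692837234969214974026178$. Then $$m_n\ \ge\ \lceil \alpha^{n+1}\rceil-2\qquad\text{for all } n\ge 1,$$ with equality for infinitely many $n$, and $$m_n\ \le\ \lfloor 1.05\cdot\alpha^{n+1}\rfloor-4\qquad\text{for all } n\ge 8.$$ In particular, $m_n=\Theta(\alpha^n)$ as $n\to\infty$. -/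

import Mathlib

/-- The number of nonempty infima closed sets of a rooted tree `T`. The vertices of `T` carry the
order in which `v ≤ w` means that `v` lies on the path from the root to `w`, and `⊓` is the
infimum for that order. -/
noncomputable def numInfClosed (T : RootedTree.{0}) : ℕ :=
  {X : Set T | X.Nonempty ∧ InfClosed X}.ncard

/-- The values of `numInfClosed` on all finite rooted trees with `n` vertices. -/
def infClosedCounts (n : ℕ) : Set ℕ :=
  {k | ∃ T : RootedTree.{0}, Finite T ∧ Nat.card T = n ∧ numInfClosed T = k}

/-- The minimum number `m_n` of nonempty infima closed sets in a rooted tree with `n` vertices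
(meaningful for `1 ≤ n`, see `isLeast_minInfClosed`). -/
noncomputable def minInfClosed (n : ℕ) : ℕ := sInf (infClosedCounts n)

/-- For `1 ≤ n` there are rooted trees with `n` vertices (for example a path), so that the minimum
is attained. -/
theorem isLeast_minInfClosed (n : ℕ) (hn : 1 ≤ n) :
    IsLeast (infClosedCounts n) (minInfClosed n) := by
  have hne : (infClosedCounts n).Nonempty := by
    obtain ⟨k, rfl⟩ : ∃ k, n = k + 1 := ⟨n - 1, by omega⟩
    let _ : PredOrder (Fin (k + 1)) := LinearLocallyFiniteOrder.predOrder _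
    let T : RootedTree.{0} := { α := Fin (k + 1) }
    exact ⟨numInfClosed T, T, inferInstanceAs (Finite (Fin (k + 1))),
      Nat.card_fin (k + 1), rfl⟩
  exact ⟨Nat.sInf_mem hne, fun _ h => Nat.sInf_le h⟩

/-- The sequence `x_1 = 13`, `x_{k+1} = x_k ^ 2 - 1`, with the index shifted by one:
`xSeq k` is `x_{k+1}`. -/
def xSeq : ℕ → ℝ
  | 0 => 13
  | k + 1 => xSeq k ^ 2 - 1

/-- The term `2^{-j-1} log (1 - x_j^{-2})` for the index `j = i + 1`. -/
noncomputable def betaTerm (i : ℕ) : ℝ :=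
  (1 / 2) ^ (i + 2) * Real.log (1 - (xSeq i ^ 2)⁻¹)

/-- `β = (1/2) log x_1 + ∑_{j ≥ 1} 2^{-j-1} log (1 - x_j^{-2})`. -/
noncomputable def betaConst : ℝ := 1 / 2 * Real.log (xSeq 0) + ∑' i : ℕ, betaTerm i

/-- `α = e^{2β/5}`. -/
noncomputable def alphaConst : ℝ := Real.exp (2 * betaConst / 5)

/-!
Write `I` for the number of nonempty infima closed sets of a tree and `J = I + 2`. A nonempty infima
closed set either contains the root, and then meets each branch at the root in an arbitrary infima
closed set, or it lies inside a single branch. So `I = ∏ (1 + I_i) + ∑ I_i` over the branches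
(`IsGraft.numInfClosed_eq`). With two branches this reads `J = J_1 J_2 - 1`, while `N = n + 1`, for
`n` the number of vertices, becomes `N = N_1 + N_2`. The star with three leaves has `N = 5` and
`J = 13`, and repeatedly joining two copies gives `N = 5 * 2 ^ k` and `J = x_{k+1}`.

The partial sums of the series for `β` telescope to `log x_k / 2 ^ k`, and together with the
increasing sequence `log (x_k - 1 / x_k) / 2 ^ k` they enclose `β`. In the shifted index of `xSeq`
this says that `α ^ (5 * 2 ^ k)` lies between `x_k - 1 / x_k` and `x_k`
(`le_alphaConst_pow`, `alphaConst_pow_le`), which also gives the decimals of `α`.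

For the lower bound, `J ≥ α ^ N` is too weak for an induction, since `J_1 J_2 - 1` loses a `1`. It is
replaced by `J ≥ f (α ^ N)`, where `f (x ^ 2) = f x ^ 2 - 1` and `f x` is slightly larger than `x`;
`f` is the increasing limit of the functions `iterSqrt k`. As `f` is log-convex in `log x`, one has
`f (x y) ≤ f x * f y - 1`, which is exactly the case of two branches (`iterSqrt_mul_le`).
Equality holds for the star with three leaves, where `f (α ^ 5) = 13`. A root with many branches is
wasteful: each branch leaves a factor at least `2 / α` to spare, or `(2 / α) ^ 2` if it is not a
single vertex, and six such factors suffice (`IsLowerBounded.graft_of_six_le`). The remaining roots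
have at most five branches, at most two of which are not single vertices
(`IsLowerBounded.graft`).

For the upper bound, write `N = r + 5 q` with `r` one of `0, 6, 12, 8, 4`, and join a good tree with
`N = r` to the trees with `J = x_j` that belong to the binary digits of `q`. The relative errors
`x_j / α ^ (5 * 2 ^ j)` have a product below `1.0032` (`exists_realizes_of_lt_two_pow`), and the
small tree costs at most a further factor `1.0452`.
-/

/-! ### The recursion over the branches at the root -/

/-- `T` is obtained by joining the roots of the trees `S i` to a new root: the maps `φ i` embed the
trees `S i` as the branches of `T` at its root. -/
structure IsGraft {ι : Type} (T : RootedTree.{0}) (S : ι → RootedTree.{0})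
    (φ : ∀ i, S i → T) : Prop where
  injective : ∀ i, Function.Injective (φ i)
  map_inf : ∀ i x y, φ i (x ⊓ y) = φ i x ⊓ φ i y
  ne_bot : ∀ i x, φ i x ≠ ⊥
  inf_eq_bot : ∀ i j x y, i ≠ j → φ i x ⊓ φ j y = ⊥
  exists_rep : ∀ t, t ≠ ⊥ → ∃ i x, φ i x = t

theorem natCard_infClosed (T : RootedTree.{0}) [Finite T] :
    Nat.card {X : Set T // InfClosed X} = 1 + numInfClosed T := by
  have h : {X : Set T | InfClosed X} = insert ∅ {X : Set T | X.Nonempty ∧ InfClosed X} := by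
    ext X
    rcases X.eq_empty_or_nonempty with rfl | hX
    · simp
    · simp [hX, hX.ne_empty]
  have h2 := Set.ncard_insert_of_notMem (a := (∅ : Set T))
    (s := {X : Set T | X.Nonempty ∧ InfClosed X}) (by simp) (Set.toFinite _)
  rw [← h] at h2
  rw [numInfClosed, add_comm, ← h2]
  exact Nat.card_coe_set_eq {X : Set T | InfClosed X}

namespace IsGraft

variable {ι : Type} {T : RootedTree.{0}} {S : ι → RootedTree.{0}} {φ : ∀ i, S i → T}

theorem eq_of_map_eq (h : IsGraft T S φ) {i j : ι} {x : S i} {y : S j} (hxy : φ i x = φ j y) :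
    i = j := by
  by_contra hij
  have := h.inf_eq_bot i j x y hij
  rw [← hxy, inf_idem] at this
  exact h.ne_bot i x this

theorem natCard_eq [Fintype ι] [∀ i, Finite (S i)] (h : IsGraft T S φ) :
    Nat.card T = 1 + ∑ i, Nat.card (S i) := by
  let f : Option (Σ i, S i) → T := fun o => o.elim ⊥ fun p => φ p.1 p.2
  have hf : Function.Bijective f := by
    constructor
    · rintro (_ | ⟨i, x⟩) (_ | ⟨j, y⟩) hxy
      · rfl
      · exact absurd hxy.symm (h.ne_bot j y)
      · exact absurd hxy (h.ne_bot i x)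
      · obtain rfl : i = j := h.eq_of_map_eq hxy
        obtain rfl : x = y := h.injective i hxy
        rfl
    · intro t
      rcases eq_or_ne t ⊥ with rfl | ht
      · exact ⟨none, rfl⟩
      · obtain ⟨i, x, rfl⟩ := h.exists_rep t ht
        exact ⟨some ⟨i, x⟩, rfl⟩
  rw [← Nat.card_congr (Equiv.ofBijective f hf), Finite.card_option, Nat.card_sigma, add_comm]

/-- An infima closed set that contains the root is given by an arbitrary, possibly empty, infima
closed set in each branch. -/
theorem natCard_infClosed_bot_mem [Fintype ι] (h : IsGraft T S φ) :
    Nat.card {X : Set T // ⊥ ∈ X ∧ InfClosed X} =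
      ∏ i, Nat.card {X : Set (S i) // InfClosed X} := by
  rw [← Nat.card_pi]
  symm
  have hcl : ∀ Y : ∀ i, {X : Set (S i) // InfClosed X},
      InfClosed (insert ⊥ (⋃ i, φ i '' (Y i).1)) := by
    rintro Y a (rfl | ha) b (rfl | hb)
    · simp
    · simp
    · simp
    · simp only [Set.mem_iUnion, Set.mem_image] at ha hb
      obtain ⟨i, x, hx, rfl⟩ := ha
      obtain ⟨j, y, hy, rfl⟩ := hb
      rcases eq_or_ne i j with rfl | hij
      · rw [← h.map_inf]
        exact Or.inr (Set.mem_iUnion.2 ⟨i, _, (Y i).2 hx hy, rfl⟩)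
      · rw [h.inf_eq_bot i j x y hij]
        exact Or.inl rfl
  have hpre : ∀ (Y : ∀ i, {X : Set (S i) // InfClosed X}) (i : ι) (x : S i),
      φ i x ∈ insert ⊥ (⋃ j, φ j '' (Y j).1) ↔ x ∈ (Y i).1 := by
    intro Y i x
    constructor
    · rintro (hx | hx)
      · exact absurd hx (h.ne_bot i x)
      · simp only [Set.mem_iUnion, Set.mem_image] at hx
        obtain ⟨j, y, hy, hyx⟩ := hx
        obtain rfl := h.eq_of_map_eq hyx
        rwa [← h.injective j hyx]
    · exact fun hx => Or.inr (Set.mem_iUnion.2 ⟨i, x, hx, rfl⟩)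
  refine Nat.card_congr (Equiv.ofBijective
    (fun Y => ⟨insert ⊥ (⋃ i, φ i '' (Y i).1), Set.mem_insert _ _, hcl Y⟩) ⟨?_, ?_⟩)
  · intro Y Z hYZ
    have hYZ' := congrArg Subtype.val hYZ
    funext i
    ext x
    simp only at hYZ'
    rw [← hpre Y, ← hpre Z, hYZ']
  · rintro ⟨X, hX, hXc⟩
    have hcl' : ∀ i, InfClosed (φ i ⁻¹' X) := by
      intro i x hx y hy
      rw [Set.mem_preimage, h.map_inf]
      exact hXc hx hy
    refine ⟨fun i => ⟨φ i ⁻¹' X, hcl' i⟩, Subtype.ext (Set.ext fun t => ?_)⟩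
    rcases eq_or_ne t ⊥ with rfl | ht
    · simp [hX]
    · obtain ⟨i, x, rfl⟩ := h.exists_rep t ht
      exact hpre (fun i => ⟨φ i ⁻¹' X, hcl' i⟩) i x

/-- A nonempty infima closed set that avoids the root lies in a single branch. -/
theorem natCard_infClosed_bot_notMem [Fintype ι] [∀ i, Finite (S i)] (h : IsGraft T S φ) :
    Nat.card {X : Set T // ⊥ ∉ X ∧ X.Nonempty ∧ InfClosed X} = ∑ i, numInfClosed (S i) := by
  have hsum : ∑ i, numInfClosed (S i) =
      Nat.card (Σ i, {X : Set (S i) // X.Nonempty ∧ InfClosed X}) := by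
    rw [Nat.card_sigma]
    exact Finset.sum_congr rfl fun i _ => (Nat.card_coe_set_eq _).symm
  rw [hsum]
  symm
  refine Nat.card_congr (Equiv.ofBijective
    (fun Y => ⟨φ Y.1 '' Y.2.1, ?_, Y.2.2.1.image _, ?_⟩) ⟨?_, ?_⟩)
  · rintro ⟨x, _, hx⟩
    exact h.ne_bot _ _ hx
  · rintro _ ⟨x, hx, rfl⟩ _ ⟨y, hy, rfl⟩
    exact ⟨_, Y.2.2.2 hx hy, h.map_inf _ _ _⟩
  · rintro ⟨i, Y, hY, hYc⟩ ⟨j, Z, hZ, hZc⟩ hYZ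
    have hYZ' : φ i '' Y = φ j '' Z := congrArg Subtype.val hYZ
    obtain ⟨x, hx⟩ := hY
    obtain ⟨y, _, hyx⟩ : φ i x ∈ φ j '' Z := hYZ' ▸ Set.mem_image_of_mem _ hx
    obtain rfl := h.eq_of_map_eq hyx
    obtain rfl := (h.injective j).image_injective hYZ'
    rfl
  · rintro ⟨X, hX, ⟨t, ht⟩, hXc⟩
    have ne : ∀ {a}, a ∈ X → a ≠ ⊥ := fun ha hb => hX (hb ▸ ha)
    obtain ⟨i, x, rfl⟩ := h.exists_rep t (ne ht)
    refine ⟨⟨i, φ i ⁻¹' X, ⟨x, ht⟩, fun a ha b hb => ?_⟩, ?_⟩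
    · rw [Set.mem_preimage, h.map_inf]
      exact hXc ha hb
    · apply Subtype.ext
      refine Set.image_preimage_eq_of_subset fun t' ht' => ?_
      obtain ⟨j, y, rfl⟩ := h.exists_rep t' (ne ht')
      rcases eq_or_ne i j with rfl | hij
      · exact ⟨y, rfl⟩
      · exact absurd (h.inf_eq_bot i j x y hij) (ne (hXc ht ht'))

/-- The recursion for the number of nonempty infima closed sets. -/
theorem numInfClosed_eq [Fintype ι] [Finite T] [∀ i, Finite (S i)] (h : IsGraft T S φ) :
    numInfClosed T = ∏ i, (1 + numInfClosed (S i)) + ∑ i, numInfClosed (S i) := by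
  have hunion : {X : Set T | X.Nonempty ∧ InfClosed X} =
      {X | ⊥ ∈ X ∧ InfClosed X} ∪ {X | ⊥ ∉ X ∧ X.Nonempty ∧ InfClosed X} := by
    ext X
    by_cases hX : ⊥ ∈ X
    · simpa [hX] using fun _ => ⟨⊥, hX⟩
    · simp [hX]
  have hdisj : Disjoint {X : Set T | ⊥ ∈ X ∧ InfClosed X}
      {X | ⊥ ∉ X ∧ X.Nonempty ∧ InfClosed X} :=
    Set.disjoint_left.2 fun X h1 h2 => h2.1 h1.1
  rw [numInfClosed, hunion, Set.ncard_union_eq hdisj (Set.toFinite _) (Set.toFinite _),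
    ← Nat.card_coe_set_eq, ← Nat.card_coe_set_eq]
  exact congrArg₂ _ (h.natCard_infClosed_bot_mem.trans
    (Finset.prod_congr rfl fun i _ => natCard_infClosed (S i))) h.natCard_infClosed_bot_notMem

end IsGraft

/-- The branch of `T` consisting of the vertices above `a`. -/
noncomputable def branch (T : RootedTree.{0}) (a : T) : RootedTree.{0} where
  α := Set.Ici a

instance (T : RootedTree.{0}) [Finite T] (a : T) : Finite (branch T a) :=
  inferInstanceAs (Finite (Set.Ici a))

/-- Every rooted tree is the graft of the branches above the children of its root, which are the
atoms of its order. -/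
theorem isGraft_branch (T : RootedTree.{0}) :
    IsGraft T (fun a : {a : T // IsAtom a} => branch T a)
      (fun a (x : Set.Ici a.1) => x.1) where
  injective _ := Subtype.val_injective
  map_inf _ _ _ := rfl
  ne_bot a x hx := a.2.1 (le_bot_iff.1 (hx ▸ x.2))
  inf_eq_bot a b x y hab := by
    by_contra hne
    -- two distinct atoms below comparable vertices would lie on a chain
    obtain ⟨c, hc, hcxy⟩ := (IsAtomic.eq_bot_or_exists_atom_le (x.1 ⊓ y.1)).resolve_left hne
    have key : ∀ (d : {a : T // IsAtom a}) (z : T), d.1 ≤ z → c ≤ z → c = d.1 := by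
      intro d z hd hcz
      rcases le_total_of_directed hd hcz with h | h
      · exact (d.2.le_iff.1 h).resolve_left hc.1
      · exact ((hc.le_iff.1 h).resolve_left d.2.1).symm
    exact hab (Subtype.ext ((key a x.1 x.2 (hcxy.trans inf_le_left)).symm.trans
      (key b y.1 y.2 (hcxy.trans inf_le_right))))
  exists_rep t ht := by
    obtain ⟨a, ha, hat⟩ := (IsAtomic.eq_bot_or_exists_atom_le t).resolve_left ht
    exact ⟨⟨a, ha⟩, ⟨t, hat⟩, rfl⟩

/-- Induction along the branches at the root. -/
theorem finite_rootedTree_induction {P : RootedTree.{0} → Prop}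
    (step : ∀ (T : RootedTree.{0}) [Finite T],
      (∀ a : {a : T // IsAtom a}, P (branch T a)) → P T)
    (T : RootedTree.{0}) [hT : Finite T] : P T := by
  induction hn : Nat.card T using Nat.strong_induction_on generalizing T with
  | _ n ih =>
    subst hn
    refine step T fun a => ih _ ?_ _ rfl
    refine (Set.ncard_lt_card (s := Set.Ici a.1) fun hU => a.2.1 ?_)
    exact le_bot_iff.1 (hU ▸ Set.mem_univ (⊥ : T) : (⊥ : T) ∈ Set.Ici a.1)

/-! ### Joining trees at a new root -/

section Join

variable {ι : Type} (S : ι → RootedTree.{0})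

/-- The disjoint union of the trees `S i` together with a new least element. -/
abbrev JoinType : Type := WithBot (Σ i, S i)

variable {S}

/-- The vertex `x` of `S i` as a vertex of the join. -/
def inJoin (i : ι) (x : S i) : JoinType S := ((⟨i, x⟩ : Σ i, S i) : WithBot (Σ i, S i))

theorem joinType_cases {P : JoinType S → Prop} (bot : P ⊥) (coe : ∀ i x, P (inJoin i x))
    (a : JoinType S) : P a := by
  induction a using WithBot.recBotCoe with
  | bot => exact bot
  | coe a => exact coe a.1 a.2

theorem inJoin_le_inJoin {i : ι} {x y : S i} : inJoin i x ≤ inJoin i y ↔ x ≤ y :=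
  WithBot.coe_le_coe.trans Sigma.mk_le_mk_iff

theorem inJoin_ne_bot {i : ι} {x : S i} : inJoin i x ≠ ⊥ := WithBot.coe_ne_bot

theorem inJoin_injective (i : ι) : Function.Injective (inJoin (S := S) i) := fun x y h => by
  simpa using WithBot.coe_inj.1 h

theorem exists_of_inJoin_le {i : ι} {x : S i} {b : JoinType S} (h : inJoin i x ≤ b) :
    ∃ y, b = inJoin i y ∧ x ≤ y := by
  induction b using joinType_cases with
  | bot => exact absurd (le_bot_iff.1 h) inJoin_ne_bot
  | coe j y =>
    obtain ⟨_, _, _, hxy⟩ := WithBot.coe_le_coe.1 h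
    exact ⟨_, rfl, hxy⟩

open Classical in
/-- The infimum in the join: vertices of distinct trees have infimum `⊥`. -/
noncomputable def joinInf : JoinType S → JoinType S → JoinType S
  | some ⟨i, x⟩, some ⟨j, y⟩ => if h : i = j then inJoin j ((h ▸ x : S j) ⊓ y) else ⊥
  | _, _ => ⊥

theorem joinInf_same (i : ι) (x y : S i) :
    joinInf (inJoin i x) (inJoin i y) = inJoin i (x ⊓ y) := dif_pos rfl

theorem joinInf_of_ne {i j : ι} (h : i ≠ j) (x : S i) (y : S j) :
    joinInf (inJoin i x) (inJoin j y) = ⊥ := dif_neg h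

theorem joinInf_bot_right (a : JoinType S) : joinInf a ⊥ = ⊥ := by
  induction a using joinType_cases <;> rfl

noncomputable instance : SemilatticeInf (JoinType S) where
  inf := joinInf
  inf_le_left a b := by
    induction a using joinType_cases with
    | bot => exact bot_le
    | coe i x =>
      induction b using joinType_cases with
      | bot => exact (joinInf_bot_right _).trans_le bot_le
      | coe j y =>
        rcases eq_or_ne i j with rfl | h
        · exact (joinInf_same i x y).trans_le (inJoin_le_inJoin.2 inf_le_left)
        · exact (joinInf_of_ne h x y).trans_le bot_le
  inf_le_right a b := by
    induction a using joinType_cases with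
    | bot => exact bot_le
    | coe i x =>
      induction b using joinType_cases with
      | bot => exact (joinInf_bot_right _).trans_le bot_le
      | coe j y =>
        rcases eq_or_ne i j with rfl | h
        · exact (joinInf_same i x y).trans_le (inJoin_le_inJoin.2 inf_le_right)
        · exact (joinInf_of_ne h x y).trans_le bot_le
  le_inf c a b hca hcb := by
    induction c using joinType_cases with
    | bot => exact bot_le
    | coe i z =>
      obtain ⟨x, rfl, hx⟩ := exists_of_inJoin_le hca
      obtain ⟨y, rfl, hy⟩ := exists_of_inJoin_le hcb
      exact (inJoin_le_inJoin.2 (le_inf hx hy)).trans_eq (joinInf_same i x y).symm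

open Classical in
/-- The parent in the join; the parent of the root of each `S i` is the new root. -/
noncomputable def joinPred : JoinType S → JoinType S
  | some ⟨i, x⟩ => if x = ⊥ then ⊥ else inJoin i (Order.pred x)
  | none => ⊥

theorem joinPred_root (i : ι) : joinPred (inJoin (S := S) i ⊥) = ⊥ := if_pos rfl

theorem joinPred_of_ne {i : ι} {x : S i} (h : x ≠ ⊥) :
    joinPred (inJoin i x) = inJoin i (Order.pred x) := if_neg h

noncomputable instance : PredOrder (JoinType S) where
  pred := joinPred
  pred_le a := by
    induction a using joinType_cases with
    | bot => exact bot_le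
    | coe i x =>
      rcases eq_or_ne x ⊥ with rfl | h
      · exact (joinPred_root i).trans_le bot_le
      · exact (joinPred_of_ne h).trans_le (inJoin_le_inJoin.2 (Order.pred_le x))
  min_of_le_pred {a} ha := by
    induction a using joinType_cases with
    | bot => exact isMin_bot
    | coe i x =>
      exfalso
      rcases eq_or_ne x ⊥ with rfl | h
      · exact inJoin_ne_bot (le_bot_iff.1 (ha.trans_eq (joinPred_root i)))
      · have h2 := inJoin_le_inJoin.1 (ha.trans_eq (joinPred_of_ne h))
        exact h (Order.min_of_le_pred h2).eq_bot
  le_pred_of_lt {a b} hab := by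
    induction a using joinType_cases with
    | bot => exact bot_le
    | coe i x =>
      obtain ⟨y, rfl, hy⟩ := exists_of_inJoin_le hab.le
      have hlt : x < y := lt_of_le_of_ne hy fun h => hab.ne (h ▸ rfl)
      exact (inJoin_le_inJoin.2 (Order.le_pred_of_lt hlt)).trans_eq
        (joinPred_of_ne (bot_le.trans_lt hlt).ne').symm

variable (S)
variable [Finite ι] [∀ i, Finite (S i)]

instance : Finite (JoinType S) := inferInstanceAs (Finite (Option (Σ i, S i)))

/-- The rooted tree whose branches at the root are the trees `S i`. -/
noncomputable def joinTree : RootedTree.{0} where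
  α := JoinType S

instance : Finite (joinTree S) := inferInstanceAs (Finite (JoinType S))

theorem isGraft_joinTree : IsGraft (joinTree S) S (inJoin (S := S)) where
  injective := inJoin_injective
  map_inf i x y := (joinInf_same i x y).symm
  ne_bot _ _ := inJoin_ne_bot
  inf_eq_bot _ _ x y h := joinInf_of_ne h x y
  exists_rep t ht := by
    induction t using joinType_cases with
    | bot => exact absurd rfl ht
    | coe i x => exact ⟨i, x, rfl⟩

end Join

/-! ### The sequence `x_k` and the constant `α` -/

theorem thirteen_le_xSeq (k : ℕ) : 13 ≤ xSeq k := by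
  induction k with
  | zero => exact le_rfl
  | succ k ih =>
    rw [xSeq]
    nlinarith

theorem xSeq_pos (k : ℕ) : 0 < xSeq k := by linarith [thirteen_le_xSeq k]

theorem sub_inv_xSeq_pos (k : ℕ) : 0 < xSeq k - (xSeq k)⁻¹ := by
  have h := thirteen_le_xSeq k
  have : (xSeq k)⁻¹ ≤ 1 := inv_le_one_of_one_le₀ (by linarith)
  linarith

/-- The partial sums of the series for `β` telescope. -/
theorem sum_betaTerm (n : ℕ) :
    1 / 2 * Real.log (xSeq 0) + ∑ i ∈ Finset.range n, betaTerm i =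
      Real.log (xSeq n) / 2 ^ (n + 1) := by
  induction n with
  | zero => simp; ring
  | succ n ih =>
    have h := thirteen_le_xSeq n
    have hx : xSeq (n + 1) = xSeq n ^ 2 * (1 - (xSeq n ^ 2)⁻¹) := by
      have : xSeq n ≠ 0 := (xSeq_pos n).ne'
      rw [xSeq]
      field_simp
    have h2 : (xSeq n ^ 2)⁻¹ < 1 := inv_lt_one_of_one_lt₀ (by nlinarith)
    rw [Finset.sum_range_succ, ← add_assoc, ih, betaTerm, hx,
      Real.log_mul (by positivity) (by linarith), Real.log_pow, one_div_pow]
    push_cast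
    rw [show n + 1 + 1 = n + 2 by rfl, pow_succ 2 (n + 1)]
    generalize Real.log (1 - (xSeq n ^ 2)⁻¹) = l
    field_simp

theorem betaTerm_nonpos (i : ℕ) : betaTerm i ≤ 0 := by
  have h := thirteen_le_xSeq i
  have h2 : (xSeq i ^ 2)⁻¹ ≤ 1 := inv_le_one_of_one_le₀ (by nlinarith)
  have h3 : 0 ≤ (xSeq i ^ 2)⁻¹ := by positivity
  exact mul_nonpos_of_nonneg_of_nonpos (by positivity)
    (Real.log_nonpos (by linarith) (by linarith))

theorem summable_betaTerm : Summable betaTerm := by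
  refine summable_neg_iff.1 (summable_of_sum_range_le (c := 1 / 2 * Real.log (xSeq 0))
    (fun i => neg_nonneg.2 (betaTerm_nonpos i)) fun n => ?_)
  have h := sum_betaTerm n
  have h2 : 0 ≤ Real.log (xSeq n) / 2 ^ (n + 1) :=
    div_nonneg (Real.log_nonneg (by linarith [thirteen_le_xSeq n])) (by positivity)
  rw [Finset.sum_neg_distrib]
  linarith

theorem tendsto_log_xSeq :
    Filter.Tendsto (fun n => Real.log (xSeq n) / 2 ^ (n + 1)) Filter.atTop (nhds betaConst) := by
  have h := (summable_betaTerm.hasSum.tendsto_sum_nat).const_add (1 / 2 * Real.log (xSeq 0))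
  simpa only [sum_betaTerm, betaConst] using h

theorem betaConst_le (k : ℕ) : betaConst ≤ Real.log (xSeq k) / 2 ^ (k + 1) := by
  have : Antitone fun n => Real.log (xSeq n) / 2 ^ (n + 1) := antitone_nat_of_succ_le fun n => by
    rw [← sum_betaTerm, ← sum_betaTerm, Finset.sum_range_succ]
    linarith [betaTerm_nonpos n]
  exact this.le_of_tendsto tendsto_log_xSeq k

/-- With `x_k = xSeq k` and `y_k = x_k - 1 / x_k` one has `y_k ^ 2 ≤ y_{k+1}`, so that `log y_k / 2 ^ (k + 1)`
increases, whereas `log x_k / 2 ^ (k + 1)` decreases to `β`. -/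
theorem le_betaConst (k : ℕ) :
    Real.log (xSeq k - (xSeq k)⁻¹) / 2 ^ (k + 1) ≤ betaConst := by
  have hmono : Monotone fun n => Real.log (xSeq n - (xSeq n)⁻¹) / 2 ^ (n + 1) :=
    monotone_nat_of_le_succ fun n => by
      have hx := thirteen_le_xSeq n
      have hpos := sub_inv_xSeq_pos n
      have hsq : (xSeq n - (xSeq n)⁻¹) ^ 2 ≤ xSeq (n + 1) - (xSeq (n + 1))⁻¹ := by
        have h1 : xSeq n * (xSeq n)⁻¹ = 1 := mul_inv_cancel₀ (xSeq_pos n).ne'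
        have h2 : (xSeq n)⁻¹ ≤ 1 / 2 := by
          rw [← one_div]
          exact one_div_le_one_div_of_le (by norm_num) (by linarith)
        have h3 : (xSeq (n + 1))⁻¹ ≤ 1 / 2 := by
          rw [← one_div]
          exact one_div_le_one_div_of_le (by norm_num) (by linarith [thirteen_le_xSeq (n + 1)])
        have h4 : 0 ≤ (xSeq n)⁻¹ := by positivity
        have h5 : xSeq (n + 1) = xSeq n ^ 2 - 1 := rfl
        nlinarith
      have hlog := Real.log_le_log (by positivity) hsq
      rw [Real.log_pow] at hlog
      rw [div_le_div_iff₀ (by positivity) (by positivity), pow_succ 2 (n + 1)]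
      push_cast at hlog
      nlinarith [show (0 : ℝ) < 2 ^ (n + 1) by positivity]
  refine ge_of_tendsto tendsto_log_xSeq (Filter.eventually_atTop.2 ⟨k, fun n hn => ?_⟩)
  refine (hmono hn).trans ?_
  have : 0 < (xSeq n)⁻¹ := inv_pos.2 (xSeq_pos n)
  simp only
  gcongr
  · exact sub_inv_xSeq_pos n
  · linarith

theorem alphaConst_pow_eq (k : ℕ) :
    alphaConst ^ (5 * 2 ^ k) = Real.exp (betaConst * 2 ^ (k + 1)) := by
  rw [alphaConst, ← Real.exp_nat_mul]
  congr 1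
  push_cast
  ring

theorem alphaConst_pow_le (k : ℕ) : alphaConst ^ (5 * 2 ^ k) ≤ xSeq k := by
  rw [alphaConst_pow_eq, ← Real.le_log_iff_exp_le (xSeq_pos k)]
  exact (le_div_iff₀ (by positivity)).1 (betaConst_le k)

theorem le_alphaConst_pow (k : ℕ) : xSeq k - (xSeq k)⁻¹ ≤ alphaConst ^ (5 * 2 ^ k) := by
  rw [alphaConst_pow_eq, ← Real.log_le_iff_le_exp (sub_inv_xSeq_pos k)]
  exact (div_le_iff₀ (by positivity)).1 (le_betaConst k)

theorem alphaConst_pos : 0 < alphaConst := Real.exp_pos _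

/-- The numerical value follows from `x - 1 / x ≤ α ^ 80 ≤ x` with `x = xSeq 4`. -/
theorem abs_alphaConst_sub_lt :
    |alphaConst - 1.6692837234969214974026178| < 1 / (2 * 10 ^ 25) := by
  have h1 := alphaConst_pow_le 4
  have h2 := le_alphaConst_pow 4
  rw [show 5 * 2 ^ 4 = 80 by norm_num] at h1 h2
  have hx : xSeq 4 = 634472352127401983 := by norm_num [xSeq]
  rw [hx] at h1 h2
  rw [abs_lt]
  constructor
  · have : (1.6692837234969214974026178 - 1 / (2 * 10 ^ 25) : ℝ) < alphaConst :=
      lt_of_pow_lt_pow_left₀ 80 alphaConst_pos.le (lt_of_lt_of_le (by norm_num) h2)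
    linarith
  · have : alphaConst < 1.6692837234969214974026178 + 1 / (2 * 10 ^ 25) :=
      lt_of_pow_lt_pow_left₀ 80 (by norm_num) (lt_of_le_of_lt h1 (by norm_num))
    linarith

theorem lt_alphaConst : 1.66928372 < alphaConst := by
  have := (abs_lt.1 abs_alphaConst_sub_lt).1
  norm_num at this ⊢
  linarith

theorem alphaConst_lt : alphaConst < 1.66928373 := by
  have := (abs_lt.1 abs_alphaConst_sub_lt).2
  norm_num at this ⊢
  linarith

theorem one_le_alphaConst : 1 ≤ alphaConst := by linarith [lt_alphaConst]

theorem alphaConst_pow_lt {m : ℕ} {c : ℝ} (hm : m ≠ 0) (h : (1.66928373 : ℝ) ^ m ≤ c) :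
    alphaConst ^ m < c :=
  (pow_lt_pow_left₀ alphaConst_lt alphaConst_pos.le hm).trans_le h

theorem lt_alphaConst_pow {m : ℕ} {c : ℝ} (hm : m ≠ 0) (h : c ≤ (1.66928372 : ℝ) ^ m) :
    c < alphaConst ^ m :=
  h.trans_lt (pow_lt_pow_left₀ lt_alphaConst (by norm_num) hm)

/-! ### The functions conjugating `x ↦ x ^ 2 - 1` to squaring -/

/-- `iterSqrt k x` is the image of `x ^ (2 ^ k)` under the `k`-th iterate of `y ↦ √(1 + y)`, the
inverse of `y ↦ y ^ 2 - 1`. As `k` grows, it increases to a function `f` with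
`f (x ^ 2) = f x ^ 2 - 1`; all bounds are stated for every `k`, so that the limit is not needed. -/
noncomputable def iterSqrt : ℕ → ℝ → ℝ
  | 0, x => x
  | k + 1, x => √(1 + iterSqrt k (x ^ 2))

theorem iterSqrt_pos {x : ℝ} (hx : 0 < x) (k : ℕ) : 0 < iterSqrt k x := by
  induction k generalizing x with
  | zero => exact hx
  | succ k ih => exact Real.sqrt_pos.2 (by linarith [ih (pow_pos hx 2)])

theorem sq_iterSqrt_succ {x : ℝ} (hx : 0 < x) (k : ℕ) :
    iterSqrt (k + 1) x ^ 2 = 1 + iterSqrt k (x ^ 2) :=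
  Real.sq_sqrt (by linarith [iterSqrt_pos (pow_pos hx 2) k])

theorem one_add_sq_le {u v w : ℝ} (hu : 0 < u) (hv : 0 < v) (h : w ^ 2 ≤ u * v) :
    (1 + w) ^ 2 ≤ (1 + u) * (1 + v) := by
  have : 2 * w ≤ u + v := abs_le_of_sq_le_sq' (by nlinarith [sq_nonneg (u - v)]) (by linarith) |>.2
  nlinarith

/-- `t ↦ iterSqrt k (eᵗ)` is log-convex: if `g` is log-convex, then so is `√(1 + g)`. -/
theorem sq_iterSqrt_mul_le {x y : ℝ} (hx : 0 < x) (hy : 0 < y) (k : ℕ) :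
    iterSqrt k (x * y) ^ 2 ≤ iterSqrt k (x ^ 2) * iterSqrt k (y ^ 2) := by
  induction k generalizing x y with
  | zero => simp only [iterSqrt]; exact (mul_pow x y 2).le
  | succ k ih =>
    have hx2 := pow_pos hx 2
    have hy2 := pow_pos hy 2
    rw [sq_iterSqrt_succ (mul_pos hx hy), mul_pow]
    refine le_of_sq_le_sq ?_ (mul_pos (iterSqrt_pos hx2 _) (iterSqrt_pos hy2 _)).le
    rw [mul_pow, sq_iterSqrt_succ hx2, sq_iterSqrt_succ hy2]
    exact one_add_sq_le (iterSqrt_pos (pow_pos hx2 2) k) (iterSqrt_pos (pow_pos hy2 2) k)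
      (ih hx2 hy2)

/-- The inequality that makes the lower bound pass to a tree with two branches. -/
theorem iterSqrt_mul_le {x y : ℝ} (hx : 0 < x) (hy : 0 < y) (k : ℕ) :
    iterSqrt k (x * y) ≤ iterSqrt (k + 1) x * iterSqrt (k + 1) y - 1 := by
  have hx2 := pow_pos hx 2
  have hy2 := pow_pos hy 2
  have : 1 + iterSqrt k (x * y) ≤ iterSqrt (k + 1) x * iterSqrt (k + 1) y := by
    refine le_of_sq_le_sq ?_ (mul_pos (iterSqrt_pos hx _) (iterSqrt_pos hy _)).le
    rw [mul_pow, sq_iterSqrt_succ hx, sq_iterSqrt_succ hy]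
    exact one_add_sq_le (iterSqrt_pos hx2 k) (iterSqrt_pos hy2 k)
      (sq_iterSqrt_mul_le hx hy k)
  linarith

/-- The constants satisfy `1 + x ^ 2 + 0.21 ≤ (x + 0.21) ^ 2` for `x ≥ 2.78`, which drives the
induction. They are chosen so that the bound holds at `α ^ 2 ≈ 2.7865` and gives at most `3` there,
as a single vertex requires. -/
theorem iterSqrt_le_add {x : ℝ} (hx : 2.78 ≤ x) (k : ℕ) : iterSqrt k x ≤ x + 0.21 := by
  induction k generalizing x with
  | zero => simp only [iterSqrt]; linarith
  | succ k ih =>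
    rw [iterSqrt, Real.sqrt_le_left (by linarith)]
    have := ih (x := x ^ 2) (by nlinarith)
    nlinarith

/-- For `j = 0` this is the case of equality of the lower bound at the star with three leaves. -/
theorem iterSqrt_alphaConst_pow_le_xSeq (k j : ℕ) :
    iterSqrt k (alphaConst ^ (5 * 2 ^ j)) ≤ xSeq j := by
  induction k generalizing j with
  | zero => exact alphaConst_pow_le j
  | succ k ih =>
    rw [iterSqrt, Real.sqrt_le_left (xSeq_pos j).le, ← pow_mul, mul_assoc, ← pow_succ]
    have := ih (j + 1)
    rw [xSeq] at this
    linarith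

theorem iterSqrt_alphaConst_pow_le {m : ℕ} (hm : 2 ≤ m) (k : ℕ) :
    iterSqrt k (alphaConst ^ m) ≤ alphaConst ^ m + 0.21 := by
  refine iterSqrt_le_add ((lt_alphaConst_pow two_ne_zero ?_).le.trans
    (pow_le_pow_right₀ one_le_alphaConst hm)) k
  norm_num

/-! ### The lower bound -/

/-- The inequality carried through the induction: for the limit `f` of `iterSqrt`, a tree with `n`
vertices and `I` nonempty infima closed sets satisfies `f (α ^ (n + 1)) ≤ I + 2`. -/
def IsLowerBounded (n I : ℕ) : Prop :=
  ∀ k, iterSqrt k (alphaConst ^ (n + 1)) ≤ I + 2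

namespace IsLowerBounded

variable {n I : ℕ}

theorem pow_le (h : IsLowerBounded n I) : alphaConst ^ (n + 1) ≤ I + 2 := h 0

theorem of_add_le (hn : 1 ≤ n) (h : alphaConst ^ (n + 1) + 0.21 ≤ I + 2) : IsLowerBounded n I :=
  fun k => (iterSqrt_alphaConst_pow_le (by omega) k).trans h

theorem le_of_lt_pow (h : IsLowerBounded n I) {m c : ℕ} (hm : m ≤ n)
    (hc : (c + 1 : ℝ) ≤ 1.66928372 ^ (m + 1)) : c ≤ I := by
  have h1 := (lt_alphaConst_pow m.succ_ne_zero hc).trans_le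
    ((pow_le_pow_right₀ one_le_alphaConst (Nat.succ_le_succ hm)).trans h.pow_le)
  have h2 : ((c + 1 : ℕ) : ℝ) < ((I + 2 : ℕ) : ℝ) := by exact_mod_cast h1
  have := Nat.cast_lt.1 h2
  omega

theorem one_le (h : IsLowerBounded n I) (hn : 1 ≤ n) : 1 ≤ I := by
  refine h.le_of_lt_pow hn ?_
  norm_num

theorem three_le (h : IsLowerBounded n I) (hn : 2 ≤ n) : 3 ≤ I := by
  refine h.le_of_lt_pow hn ?_
  norm_num

theorem six_le (h : IsLowerBounded n I) (hn : 3 ≤ n) : 6 ≤ I := by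
  refine h.le_of_lt_pow hn ?_
  norm_num

/-- In a tree with many branches, each branch contributes at least one factor `2 / α` to spare, and
two such factors if it is not a single vertex. -/
theorem pow_mul_le (h : IsLowerBounded n I) (hn : 1 ≤ n) :
    (2 / alphaConst) ^ (if n = 1 then 1 else 2) * alphaConst ^ n ≤ 1 + I := by
  have h0 := alphaConst_pos
  split_ifs with h1
  · subst h1
    have : (1 : ℝ) ≤ I := by exact_mod_cast h.one_le le_rfl
    rw [pow_one, pow_one, div_mul_cancel₀ _ h0.ne']
    linarith
  rcases (show n = 2 ∨ 3 ≤ n by omega) with rfl | h3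
  · have : (3 : ℝ) ≤ I := by exact_mod_cast h.three_le le_rfl
    rw [div_pow, div_mul_cancel₀ _ (by positivity)]
    linarith
  · have h4 := h.pow_le
    have h5 : (4.65 : ℝ) < alphaConst ^ n := (lt_alphaConst_pow (m := 3) (by norm_num)
      (by norm_num)).trans_le (pow_le_pow_right₀ one_le_alphaConst h3)
    have h6 : (2 / alphaConst) ^ 2 ≤ 1.4356 := by
      rw [div_pow, div_le_iff₀ (by positivity)]
      nlinarith [lt_alphaConst_pow (m := 2) (c := 2.7865) (by norm_num) (by norm_num)]
    rw [pow_succ] at h4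
    nlinarith [lt_alphaConst]

/-! #### Trees with at most two branches -/

theorem leaf : IsLowerBounded 1 1 := by
  refine of_add_le le_rfl ?_
  have := alphaConst_pow_lt (m := 2) (c := 2.7866) (by norm_num) (by norm_num)
  norm_num at this ⊢
  linarith

theorem one_branch (h : IsLowerBounded n I) (hn : 1 ≤ n) :
    IsLowerBounded (1 + n) (1 + I + I) := by
  refine of_add_le (by omega) ?_
  push_cast
  rcases hn.eq_or_lt with rfl | h2
  · have : (1 : ℝ) ≤ I := by exact_mod_cast h.one_le le_rfl
    have := alphaConst_pow_lt (m := 3) (c := 4.66) (by norm_num) (by norm_num)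
    norm_num at this ⊢
    linarith
  · have h3 : (3 : ℝ) ≤ I := by exact_mod_cast h.three_le h2
    have h4 := h.pow_le
    rw [show 1 + n + 1 = (n + 1) + 1 by omega, pow_succ]
    nlinarith [alphaConst_lt, alphaConst_pos]

theorem two_branches (h : IsLowerBounded n I) {m K : ℕ} (h' : IsLowerBounded m K) :
    IsLowerBounded (1 + (n + m)) ((1 + I) * (1 + K) + (I + K)) := by
  intro k
  have h0 := alphaConst_pos
  have h1 := iterSqrt_mul_le (pow_pos h0 (n + 1)) (pow_pos h0 (m + 1)) k
  have h2 := mul_le_mul (h (k + 1)) (h' (k + 1)) (iterSqrt_pos (pow_pos h0 _) _).le (by positivity)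
  rw [← pow_add, show n + 1 + (m + 1) = 1 + (n + m) + 1 by omega] at h1
  push_cast
  nlinarith

/-! #### The exceptional trees with at least three branches -/

theorem star_three : IsLowerBounded 4 11 := fun k => by
  have := iterSqrt_alphaConst_pow_le_xSeq k 0
  norm_num [xSeq] at this ⊢
  exact this

theorem star_four : IsLowerBounded 5 20 := by
  refine of_add_le (by norm_num) ?_
  have := alphaConst_pow_lt (m := 6) (c := 21.7) (by norm_num) (by norm_num)
  norm_num at this ⊢
  linarith

theorem star_five : IsLowerBounded 6 37 := by
  refine of_add_le (by norm_num) ?_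
  have := alphaConst_pow_lt (m := 7) (c := 37) (by norm_num) (by norm_num)
  norm_num at this ⊢
  linarith

theorem two_leaves_add_branch (h : IsLowerBounded n I) (hn : 2 ≤ n) :
    IsLowerBounded (1 + (2 + n)) (4 * (1 + I) + (2 + I)) := by
  refine of_add_le (by omega) ?_
  push_cast
  rcases (show n = 2 ∨ 3 ≤ n by omega) with rfl | h3
  · have : (3 : ℝ) ≤ I := by exact_mod_cast h.three_le le_rfl
    have := alphaConst_pow_lt (m := 6) (c := 21.7) (by norm_num) (by norm_num)
    norm_num at this ⊢
    linarith
  · have h6 : (6 : ℝ) ≤ I := by exact_mod_cast h.six_le h3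
    have h4 := h.pow_le
    have := alphaConst_pow_lt (m := 3) (c := 4.652) (by norm_num) (by norm_num)
    rw [show 1 + (2 + n) + 1 = (n + 1) + 3 by omega, pow_add]
    have := mul_le_mul h4 this.le (pow_pos alphaConst_pos 3).le (by positivity)
    linarith

theorem three_leaves_add_branch (h : IsLowerBounded n I) (hn : 2 ≤ n) :
    IsLowerBounded (1 + (3 + n)) (8 * (1 + I) + (3 + I)) := by
  refine of_add_le (by omega) ?_
  push_cast
  have h3 : (3 : ℝ) ≤ I := by exact_mod_cast h.three_le hn
  have h4 := h.pow_le
  have := alphaConst_pow_lt (m := 4) (c := 7.77) (by norm_num) (by norm_num)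
  rw [show 1 + (3 + n) + 1 = (n + 1) + 4 by omega, pow_add]
  have := mul_le_mul h4 this.le (pow_pos alphaConst_pos 4).le (by positivity)
  linarith

theorem leaf_add_two_branches (h : IsLowerBounded n I) (hn : 2 ≤ n) {m K : ℕ}
    (h' : IsLowerBounded m K) (hm : 2 ≤ m) :
    IsLowerBounded (1 + (1 + (n + m))) (2 * ((1 + I) * (1 + K)) + (1 + (I + K))) := by
  refine of_add_le (by omega) ?_
  push_cast
  have hI : (3 : ℝ) ≤ I := by exact_mod_cast h.three_le hn
  have hK : (3 : ℝ) ≤ K := by exact_mod_cast h'.three_le hm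
  -- the crude bound `α ^ (n + 1) ≤ I + 2` is too lossy when both branches have two vertices
  by_cases hnm : n = 2 ∧ m = 2
  · obtain ⟨rfl, rfl⟩ := hnm
    have := alphaConst_pow_lt (m := 7) (c := 37) (by norm_num) (by norm_num)
    norm_num at this ⊢
    nlinarith
  · have h4 := mul_le_mul h.pow_le h'.pow_le (pow_pos alphaConst_pos _).le (by positivity)
    have h5 := mul_le_mul h4 alphaConst_lt.le alphaConst_pos.le (by positivity)
    rw [show 1 + (1 + (n + m)) + 1 = (n + 1) + (m + 1) + 1 by omega, pow_succ, pow_add]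
    rcases (show 3 ≤ n ∨ 3 ≤ m by omega) with h3 | h3
    · have h6 : (6 : ℝ) ≤ I := by exact_mod_cast h.six_le h3
      nlinarith [mul_nonneg (sub_nonneg.2 h6) (sub_nonneg.2 hK)]
    · have h6 : (6 : ℝ) ≤ K := by exact_mod_cast h'.six_le h3
      nlinarith [mul_nonneg (sub_nonneg.2 h6) (sub_nonneg.2 hI)]

theorem mono (h : IsLowerBounded n I) {J : ℕ} (hIJ : I ≤ J) : IsLowerBounded n J := fun k =>
  (h k).trans (by gcongr)

/-! #### The induction step -/

variable {ι : Type} [Fintype ι] {n I : ι → ℕ}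

/-- At least six factors `2 / α` are enough, because `α ^ 8 ≤ 2 ^ 6`. -/
theorem graft_of_six_le (hn : ∀ i, 1 ≤ n i) (h : ∀ i, IsLowerBounded (n i) (I i))
    (hw : 6 ≤ ∑ i, if n i = 1 then 1 else 2) :
    IsLowerBounded (1 + ∑ i, n i) (∏ i, (1 + I i) + ∑ i, I i) := by
  refine of_add_le (by omega) ?_
  have h0 := alphaConst_pos
  have h1 : ∏ i, ((2 / alphaConst) ^ (if n i = 1 then 1 else 2) * alphaConst ^ n i) ≤
      ∏ i, (1 + I i : ℝ) :=
    Finset.prod_le_prod (fun i _ => by positivity) fun i _ => (h i).pow_mul_le (hn i)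
  rw [Finset.prod_mul_distrib, Finset.prod_pow_eq_pow_sum, Finset.prod_pow_eq_pow_sum] at h1
  have h2 : alphaConst ^ 2 ≤ (2 / alphaConst) ^ (∑ i, if n i = 1 then 1 else 2) := by
    refine le_trans ?_ (pow_le_pow_right₀ ?_ hw)
    · rw [div_pow, le_div_iff₀ (by positivity), ← pow_add]
      exact (alphaConst_pow_lt (by norm_num) (by norm_num)).le
    · rw [one_le_div h0]
      linarith [alphaConst_lt]
  have h3 := mul_le_mul_of_nonneg_right h2 (pow_pos h0 (∑ i, n i)).le
  rw [← pow_add] at h3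
  rw [show 1 + ∑ i, n i + 1 = 2 + ∑ i, n i by omega]
  push_cast
  have h4 : (0 : ℝ) ≤ ∑ i, (I i : ℝ) := Finset.sum_nonneg fun i _ => Nat.cast_nonneg _
  linarith

theorem graft (hn : ∀ i, 1 ≤ n i) (h : ∀ i, IsLowerBounded (n i) (I i)) :
    IsLowerBounded (1 + ∑ i, n i) (∏ i, (1 + I i) + ∑ i, I i) := by
  classical
  rcases le_or_gt 6 (∑ i, if n i = 1 then 1 else 2) with hw | hw
  · exact graft_of_six_le hn h hw
  rcases (show Fintype.card ι = 0 ∨ Fintype.card ι = 1 ∨ Fintype.card ι = 2 ∨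
    3 ≤ Fintype.card ι by omega) with hc | hc | hc | hc
  · have := Fintype.card_eq_zero_iff.1 hc
    simpa using leaf
  · obtain ⟨i, hi⟩ := Finset.card_eq_one.1 (Finset.card_univ.trans hc)
    rw [hi]
    simpa using (h i).one_branch (hn i)
  · obtain ⟨i, j, hij, hi⟩ := Finset.card_eq_two.1 (Finset.card_univ.trans hc)
    rw [hi, Finset.sum_pair hij, Finset.prod_pair hij, Finset.sum_pair hij]
    exact (h i).two_branches (h j)
  set L := Finset.univ.filter fun i => n i = 1
  set M := Finset.univ.filter fun i => ¬ n i = 1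
  have hcard : L.card + M.card = Fintype.card ι :=
    (Finset.card_filter_add_card_filter_not _).trans Finset.card_univ
  have hw2 : L.card + 2 * M.card < 6 := by
    rw [Finset.sum_ite, Finset.sum_const, Finset.sum_const] at hw
    simp only [smul_eq_mul, mul_one] at hw
    rw [mul_comm 2]
    exact hw
  have hsplit : ∀ g : ι → ℕ, ∑ i, g i = ∑ i ∈ L, g i + ∑ i ∈ M, g i := fun g =>
    (Finset.sum_filter_add_sum_filter_not _ _ _).symm
  have hLn : ∑ i ∈ L, n i = L.card := by
    rw [Finset.sum_congr rfl fun i hi => (Finset.mem_filter.1 hi).2, Finset.sum_const,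
      smul_eq_mul, mul_one]
  have hLI : L.card ≤ ∑ i ∈ L, I i := by
    simpa using Finset.card_nsmul_le_sum L I 1 fun i _ => (h i).one_le (hn i)
  have hLp : 2 ^ L.card ≤ ∏ i ∈ L, (1 + I i) :=
    Finset.pow_card_le_prod _ _ _ fun i _ => by have := (h i).one_le (hn i); omega
  have hM2 : ∀ i ∈ M, 2 ≤ n i := fun i hi => by
    have := (Finset.mem_filter.1 hi).2
    have := hn i
    omega
  have hbound : 2 ^ L.card * ∏ i ∈ M, (1 + I i) + (L.card + ∑ i ∈ M, I i) ≤
      ∏ i, (1 + I i) + ∑ i, I i := by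
    rw [← Finset.prod_filter_mul_prod_filter_not Finset.univ (fun i => n i = 1), hsplit I]
    gcongr
  refine mono ?_ hbound
  rw [hsplit n, hLn]
  rcases (show M.card = 0 ∨ M.card = 1 ∨ M.card = 2 by omega) with hm | hm | hm
  · rw [Finset.card_eq_zero.1 hm]
    rcases (show L.card = 3 ∨ L.card = 4 ∨ L.card = 5 by omega) with hl | hl | hl <;> rw [hl]
    · exact star_three
    · exact star_four
    · exact star_five
  · obtain ⟨i, hi⟩ := Finset.card_eq_one.1 hm
    have hi2 := hM2 i (by simp [hi])
    rw [hi, Finset.sum_singleton, Finset.sum_singleton, Finset.prod_singleton]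
    rcases (show L.card = 2 ∨ L.card = 3 by omega) with hl | hl <;> rw [hl]
    · exact (h i).two_leaves_add_branch hi2
    · exact (h i).three_leaves_add_branch hi2
  · obtain ⟨i, j, hij, hi⟩ := Finset.card_eq_two.1 hm
    have hl : L.card = 1 := by omega
    rw [hi, hl, Finset.sum_pair hij, Finset.prod_pair hij, Finset.sum_pair hij]
    exact (h i).leaf_add_two_branches (hM2 i (by simp [hi])) (h j) (hM2 j (by simp [hi]))

end IsLowerBounded

theorem isLowerBounded_numInfClosed (T : RootedTree.{0}) [Finite T] :
    IsLowerBounded (Nat.card T) (numInfClosed T) := by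
  refine finite_rootedTree_induction
    (P := fun T => IsLowerBounded (Nat.card T) (numInfClosed T)) (fun T _ ih => ?_) T
  have := Fintype.ofFinite {a : T // IsAtom a}
  rw [(isGraft_branch T).natCard_eq, (isGraft_branch T).numInfClosed_eq]
  exact IsLowerBounded.graft (fun a => Nat.card_pos) ih

theorem alphaConst_pow_le_minInfClosed {n : ℕ} (hn : 1 ≤ n) :
    alphaConst ^ (n + 1) ≤ minInfClosed n + 2 := by
  obtain ⟨T, _, hT, hk⟩ := (isLeast_minInfClosed n hn).1
  rw [← hk, ← hT]
  exact (isLowerBounded_numInfClosed T).pow_le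

/-! ### Trees with few infima closed sets -/

/-- Some rooted tree has `N - 1` vertices and `J - 2` nonempty infima closed sets. The shifts by
one and two make the join of two trees take the simple form `(N + N', J * J' - 1)`. -/
def Realizes (N J : ℕ) : Prop :=
  ∃ T : RootedTree.{0}, Finite T ∧ Nat.card T + 1 = N ∧ numInfClosed T + 2 = J

namespace Realizes

theorem minInfClosed_le {n J : ℕ} (h : Realizes (n + 1) J) : minInfClosed n + 2 ≤ J := by
  obtain ⟨T, hT, hN, rfl⟩ := h
  have hmem : numInfClosed T ∈ infClosedCounts n := ⟨T, hT, by omega, rfl⟩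
  exact Nat.add_le_add_right (Nat.sInf_le hmem) 2

theorem two_le {N J : ℕ} (h : Realizes N J) : 2 ≤ J := by
  obtain ⟨T, _, _, rfl⟩ := h
  omega

theorem of_joinTree {ι : Type} [Fintype ι] (S : ι → RootedTree.{0}) [∀ i, Finite (S i)] :
    Realizes (∑ i, Nat.card (S i) + 2)
      (∏ i, (1 + numInfClosed (S i)) + ∑ i, numInfClosed (S i) + 2) := by
  refine ⟨joinTree S, inferInstance, ?_, ?_⟩
  · rw [(isGraft_joinTree S).natCard_eq]
    omega
  · rw [(isGraft_joinTree S).numInfClosed_eq]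

theorem leaf : Realizes 2 3 := by
  have : ∀ i : Empty, Finite (i.elim : RootedTree.{0}) := fun i => i.elim
  simpa using of_joinTree (ι := Empty) (fun i => i.elim)

/-- The tree whose root has `m` children, all of them leaves. -/
theorem star (m : ℕ) : Realizes (m + 2) (2 ^ m + m + 2) := by
  obtain ⟨T, _, hN, hJ⟩ := leaf
  have hN' : Nat.card T = 1 := by omega
  have hJ' : numInfClosed T = 1 := by omega
  simpa [hN', hJ'] using of_joinTree (ι := Fin m) (fun _ => T)

theorem join {N N' J J' : ℕ} (h : Realizes N J) (h' : Realizes N' J') :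
    Realizes (N + N') (J * J' - 1) := by
  obtain ⟨T, _, rfl, rfl⟩ := h
  obtain ⟨T', _, rfl, rfl⟩ := h'
  have : ∀ b : Bool, Finite (bif b then T else T' : RootedTree.{0}) := by
    rintro (_ | _) <;> assumption
  have := of_joinTree (ι := Bool) (fun b => bif b then T else T')
  simp only [Fintype.sum_bool, Fintype.prod_bool, cond_true, cond_false] at this
  convert this using 1
  · omega
  · generalize numInfClosed T = a
    generalize numInfClosed T' = b
    rw [Nat.sub_eq_iff_eq_add (by nlinarith)]
    ring

end Realizes

/-- The sequence `x_k`, shifted in index like `xSeq`, as natural numbers. -/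
def xNat : ℕ → ℕ
  | 0 => 13
  | k + 1 => xNat k * xNat k - 1

theorem cast_xNat (k : ℕ) : (xNat k : ℝ) = xSeq k := by
  induction k with
  | zero => norm_num [xNat, xSeq]
  | succ k ih =>
    have : 1 ≤ xNat k := by
      have := thirteen_le_xSeq k
      rw [← ih] at this
      exact_mod_cast (by linarith : (1 : ℝ) ≤ xNat k)
    rw [xNat, xSeq, Nat.cast_sub (Nat.one_le_iff_ne_zero.2 (by positivity)), ← ih]
    push_cast
    ring

theorem realizes_xNat (k : ℕ) : Realizes (5 * 2 ^ k) (xNat k) := by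
  induction k with
  | zero => exact Realizes.star 3
  | succ k ih =>
    have := ih.join ih
    rwa [show 5 * 2 ^ k + 5 * 2 ^ k = 5 * 2 ^ (k + 1) by ring] at this

/-- Joining the trees for the binary digits of `q` multiplies the relative errors
`x_j / α ^ (5 * 2 ^ j)`, whose product stays below `1.0032`. The correction `3 / x_k ^ 2` leaves
room for the digits from the `k`-th on. -/
theorem exists_realizes_of_lt_two_pow (k q : ℕ) (hq : 1 ≤ q) (hqk : q < 2 ^ (k + 1)) :
    ∃ J, Realizes (5 * q) J ∧
      (J : ℝ) ≤ (1.0032 - 3 / xSeq (k + 1) ^ 2) * alphaConst ^ (5 * q) := by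
  have h0 := alphaConst_pos
  induction k generalizing q with
  | zero =>
    obtain rfl : q = 1 := by omega
    refine ⟨13, Realizes.star 3, ?_⟩
    have := lt_alphaConst_pow (m := 5) (c := 12.9613) (by norm_num) (by norm_num)
    norm_num [xSeq] at this ⊢
    linarith
  | succ k ih =>
    set x := xSeq (k + 1) with hx
    have hx13 : 13 ≤ x := thirteen_le_xSeq _
    have hx' : xSeq (k + 1 + 1) = x ^ 2 - 1 := rfl
    have hsq : 168 ≤ x ^ 2 - 1 := by nlinarith
    have hmono : 3 / (x ^ 2 - 1) ^ 2 ≤ 3 / x ^ 2 := by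
      gcongr
      nlinarith
    have hfac : x * (1.0032 - 3 / x ^ 2) ≤ (x - x⁻¹) * (1.0032 - 3 / (x ^ 2 - 1) ^ 2) := by
      have e1 : x * (1.0032 - 3 / x ^ 2) = 1.0032 * x - 3 / x := by field_simp
      have e2 : (x - x⁻¹) * (1.0032 - 3 / (x ^ 2 - 1) ^ 2) =
          1.0032 * x - (1.0032 + 3 / (x ^ 2 - 1)) / x := by
        have : x ^ 2 - 1 ≠ 0 := by linarith
        field_simp
        ring
      have e3 : 3 / (x ^ 2 - 1) ≤ 1 := by
        rw [div_le_one (by linarith)]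
        linarith
      rw [e1, e2]
      have : (1.0032 + 3 / (x ^ 2 - 1)) / x ≤ 3 / x := by
        gcongr
        linarith
      linarith
    have hone : (1 : ℝ) ≤ 1.0032 - 3 / x ^ 2 := by
      have hxk : (168 : ℝ) ≤ x := by
        rw [hx, xSeq]
        nlinarith [thirteen_le_xSeq k]
      have : 3 / x ^ 2 ≤ 0.0032 := by
        rw [div_le_iff₀ (by positivity)]
        nlinarith
      linarith
    have hdigit : x * (1.0032 - 3 / x ^ 2) ≤
        (1.0032 - 3 / (x ^ 2 - 1) ^ 2) * alphaConst ^ (5 * 2 ^ (k + 1)) :=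
      hfac.trans ((mul_le_mul_of_nonneg_right (le_alphaConst_pow (k + 1)) (by linarith)).trans_eq
        (mul_comm _ _))
    rw [hx']
    rcases lt_trichotomy q (2 ^ (k + 1)) with hlt | rfl | hgt
    · obtain ⟨J, hJ, hle⟩ := ih q hq hlt
      refine ⟨J, hJ, hle.trans ?_⟩
      gcongr
    · refine ⟨_, realizes_xNat (k + 1), ?_⟩
      rw [cast_xNat]
      nlinarith
    · obtain ⟨r, rfl⟩ := Nat.exists_eq_add_of_lt hgt
      rw [pow_succ] at hqk
      obtain ⟨J, hJ, hle⟩ := ih (r + 1) (by omega) (by rw [pow_succ]; omega)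
      refine ⟨_, by simpa [mul_add, add_assoc] using (realizes_xNat (k + 1)).join hJ, ?_⟩
      calc ((xNat (k + 1) * J - 1 : ℕ) : ℝ) ≤ ((xNat (k + 1) * J : ℕ) : ℝ) := by
            exact_mod_cast Nat.sub_le _ _
        _ = x * J := by rw [Nat.cast_mul, cast_xNat]
        _ ≤ x * ((1.0032 - 3 / x ^ 2) * alphaConst ^ (5 * (r + 1))) := by gcongr
        _ = x * (1.0032 - 3 / x ^ 2) * alphaConst ^ (5 * (r + 1)) := by ring
        _ ≤ (1.0032 - 3 / (x ^ 2 - 1) ^ 2) * alphaConst ^ (5 * 2 ^ (k + 1)) *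
            alphaConst ^ (5 * (r + 1)) := by gcongr
        _ = _ := by ring

theorem exists_realizes_five_mul {q : ℕ} (hq : 1 ≤ q) :
    ∃ J, Realizes (5 * q) J ∧ (J : ℝ) ≤ 1.0032 * alphaConst ^ (5 * q) := by
  obtain ⟨J, hJ, hle⟩ := exists_realizes_of_lt_two_pow q q hq
    (Nat.lt_two_pow_self.trans (Nat.pow_lt_pow_right one_lt_two q.lt_succ_self))
  refine ⟨J, hJ, hle.trans ?_⟩
  have : 0 < 3 / xSeq (q + 1) ^ 2 := div_pos (by norm_num) (pow_pos (xSeq_pos _) 2)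
  have := pow_pos alphaConst_pos (5 * q)
  gcongr
  linarith

/-- The summand `0.08`, multiplied by `α ^ (5 * q) ≥ 12.9`, makes up for the `1` by which
`J * K - 1 + 2` exceeds `J * K`. -/
theorem exists_realizes_add_five_mul {N J q : ℕ} {c : ℝ} (h : Realizes N J)
    (hc : c ≤ (1.66928372 : ℝ) ^ N) (hN : N ≠ 0) (hJ : 1.0032 * J + 0.08 ≤ 1.05 * c)
    (hq : 1 ≤ q) :
    ∃ J, Realizes (N + 5 * q) J ∧ (J : ℝ) + 2 ≤ 1.05 * alphaConst ^ (N + 5 * q) := by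
  obtain ⟨K, hK, hle⟩ := exists_realizes_five_mul hq
  refine ⟨_, h.join hK, ?_⟩
  have h1 : 1 ≤ J * K := Nat.one_le_iff_ne_zero.2
    (Nat.mul_ne_zero (by have := h.two_le; omega) (by have := hK.two_le; omega))
  have h2 : (12.9 : ℝ) < alphaConst ^ (5 * q) :=
    (lt_alphaConst_pow (m := 5) (by norm_num) (by norm_num)).trans_le
      (pow_le_pow_right₀ one_le_alphaConst (by omega))
  have h3 := lt_alphaConst_pow hN hc
  have h4 := mul_le_mul_of_nonneg_left hle J.cast_nonneg
  have h5 : (1.0032 * J + 0.08) * alphaConst ^ (5 * q) ≤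
      1.05 * alphaConst ^ N * alphaConst ^ (5 * q) :=
    mul_le_mul_of_nonneg_right (by linarith) (by linarith)
  rw [Nat.cast_sub h1, pow_add]
  push_cast
  linarith

theorem exists_realizes {N : ℕ} (hN : 9 ≤ N) :
    ∃ J, Realizes N J ∧ (J : ℝ) + 2 ≤ 1.05 * alphaConst ^ N := by
  have h4 : Realizes 4 8 := Realizes.leaf.join Realizes.leaf
  have h6 : Realizes 6 22 := Realizes.star 4
  have h8 : Realizes 8 63 := h4.join h4
  have h12 : Realizes 12 483 := h6.join h6
  obtain ⟨q, hq⟩ : ∃ q, N = 5 * q ∨ N = 6 + 5 * q ∨ N = 12 + 5 * q ∨ N = 8 + 5 * q ∨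
      N = 4 + 5 * q := by
    have : N % 5 = 0 ∨ N % 5 = 1 ∨ N % 5 = 2 ∨ N % 5 = 3 ∨ N % 5 = 4 := by omega
    rcases this with h | h | h | h | h
    · exact ⟨N / 5, by omega⟩
    · exact ⟨(N - 6) / 5, by omega⟩
    · exact ⟨(N - 12) / 5, by omega⟩
    · exact ⟨(N - 8) / 5, by omega⟩
    · exact ⟨(N - 4) / 5, by omega⟩
  rcases hq with rfl | rfl | rfl | rfl | rfl
  · obtain ⟨J, hJ, hle⟩ := exists_realizes_five_mul (q := q) (by omega)
    have : (160 : ℝ) < alphaConst ^ (5 * q) :=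
      (lt_alphaConst_pow (m := 10) (by norm_num) (by norm_num)).trans_le
        (pow_le_pow_right₀ one_le_alphaConst (by omega))
    exact ⟨J, hJ, by linarith⟩
  · exact exists_realizes_add_five_mul (c := 21.6) h6 (by norm_num) (by norm_num) (by norm_num)
      (by omega)
  · rcases q.eq_zero_or_pos with rfl | hq
    · refine ⟨_, h12, ?_⟩
      have := lt_alphaConst_pow (m := 12) (c := 468) (by norm_num) (by norm_num)
      norm_num at this ⊢
      linarith
    · exact exists_realizes_add_five_mul (c := 468) h12 (by norm_num) (by norm_num) (by norm_num) hq
  · exact exists_realizes_add_five_mul (c := 60.28) h8 (by norm_num) (by norm_num) (by norm_num)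
      (by omega)
  · exact exists_realizes_add_five_mul (c := 7.76) h4 (by norm_num) (by norm_num) (by norm_num)
      (by omega)

theorem minInfClosed_le_alphaConst_pow {n : ℕ} (hn : 8 ≤ n) :
    (minInfClosed n : ℝ) + 4 ≤ 1.05 * alphaConst ^ (n + 1) := by
  obtain ⟨J, hJ, hle⟩ := exists_realizes (N := n + 1) (by omega)
  have : ((minInfClosed n + 2 : ℕ) : ℝ) ≤ J := Nat.cast_le.2 hJ.minInfClosed_le
  push_cast at this
  linarith

theorem ceil_alphaConst_pow (k : ℕ) : ⌈alphaConst ^ (5 * 2 ^ k)⌉ = xNat k := by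
  rw [Int.ceil_eq_iff]
  have hx := cast_xNat k
  refine ⟨lt_of_lt_of_le ?_ (le_alphaConst_pow k), ?_⟩
  · have : (xSeq k)⁻¹ < 1 := inv_lt_one_of_one_lt₀ (by linarith [thirteen_le_xSeq k])
    push_cast
    linarith
  · exact_mod_cast (alphaConst_pow_le k).trans_eq hx.symm

theorem ceil_sub_two_le_minInfClosed {n : ℕ} (hn : 1 ≤ n) :
    ⌈alphaConst ^ (n + 1)⌉ - 2 ≤ (minInfClosed n : ℤ) := by
  rw [sub_le_iff_le_add, Int.ceil_le]
  exact_mod_cast alphaConst_pow_le_minInfClosed hn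

theorem infinite_setOf_minInfClosed_eq :
    {n : ℕ | 1 ≤ n ∧ (minInfClosed n : ℤ) = ⌈alphaConst ^ (n + 1)⌉ - 2}.Infinite := by
  refine Set.infinite_of_injective_forall_mem (f := fun k : ℕ => 5 * 2 ^ k - 1) ?_ fun k => ?_
  · intro a b hab
    have := Nat.one_le_two_pow (n := a)
    have := Nat.one_le_two_pow (n := b)
    exact Nat.pow_right_injective le_rfl (by simp only at hab ⊢; omega)
  · have h1 := Nat.one_le_two_pow (n := k)
    have hk : 5 * 2 ^ k - 1 + 1 = 5 * 2 ^ k := by omega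
    have hn : 1 ≤ 5 * 2 ^ k - 1 := by omega
    refine ⟨hn, le_antisymm ?_ (ceil_sub_two_le_minInfClosed hn)⟩
    have := (show Realizes (5 * 2 ^ k - 1 + 1) _ from hk ▸ realizes_xNat k).minInfClosed_le
    rw [hk, ceil_alphaConst_pow]
    omega

theorem isTheta_minInfClosed :
    Asymptotics.IsTheta Filter.atTop (fun n : ℕ => (minInfClosed n : ℝ))
      (fun n : ℕ => alphaConst ^ n) := by
  have h0 := alphaConst_pos
  constructor
  · refine Asymptotics.IsBigO.of_bound 2 (Filter.eventually_atTop.2 ⟨8, fun n hn => ?_⟩)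
    have := minInfClosed_le_alphaConst_pow hn
    have := pow_pos h0 n
    rw [Real.norm_of_nonneg (Nat.cast_nonneg _), Real.norm_of_nonneg this.le]
    rw [pow_succ] at *
    nlinarith [alphaConst_lt]
  · refine Asymptotics.IsBigO.of_bound 1 (Filter.eventually_atTop.2 ⟨8, fun n hn => ?_⟩)
    have h1 := alphaConst_pow_le_minInfClosed (n := n) (by omega)
    have h2 := lt_alphaConst_pow (m := 8) (c := 3) (by norm_num) (by norm_num)
    have h3 := pow_le_pow_right₀ one_le_alphaConst hn
    rw [Real.norm_of_nonneg (Nat.cast_nonneg _), Real.norm_of_nonneg (pow_pos h0 n).le]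
    rw [pow_succ] at h1
    nlinarith [lt_alphaConst]

theorem theorem2 :
    -- the series that defines `β` converges, and `α` has the stated numerical value
    Summable betaTerm ∧
    |alphaConst - 1.6692837234969214974026178| < 1 / (2 * 10 ^ 25) ∧
    -- lower bound, with equality for infinitely many `n`
    (∀ n : ℕ, 1 ≤ n → ⌈alphaConst ^ (n + 1)⌉ - 2 ≤ (minInfClosed n : ℤ)) ∧
    {n : ℕ | 1 ≤ n ∧ (minInfClosed n : ℤ) = ⌈alphaConst ^ (n + 1)⌉ - 2}.Infinite ∧
    -- upper bound
    (∀ n : ℕ, 8 ≤ n → (minInfClosed n : ℤ) ≤ ⌊(1.05 : ℝ) * alphaConst ^ (n + 1)⌋ - 4) ∧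
    -- order of growth
    Asymptotics.IsTheta Filter.atTop (fun n : ℕ => (minInfClosed n : ℝ))
      (fun n : ℕ => alphaConst ^ n) := by
  refine ⟨summable_betaTerm, abs_alphaConst_sub_lt, fun n => ceil_sub_two_le_minInfClosed,
    infinite_setOf_minInfClosed_eq, fun n hn => ?_, isTheta_minInfClosed⟩
  rw [le_sub_iff_add_le, Int.le_floor]
  exact_mod_cast minInfClosed_le_alphaConst_pow hn
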